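/- Let $\mathbb D=\{z\in\mathbb C:|z|<1\}$, and let $A$ be an analytic function in $\mathbb D$ for which there is a constant $0<C<\infty$ such that $$|A(z)|\,(1-|z|^2)^2\le 1+C(1-|z|),\qquad z\in\mathbb D.$$ Let $f_1,f_2$ be two linearly independent (over $\mathbb C$) analytic solutions of $f''+Af=0$ in $\mathbb D$, and let $\{z_n\}$ and $\{\zeta_m\}$ be the (possibly finite or empty) sequences of all zeros in $\mathbb D$ of $f_1$ and $f_2$, respectively. Then there is a constant $\delta=\delta(f_1,f_2)>0$ such that $$\varrho_h(z_n,\zeta_m)>\delta\qquad\text{for all } n \text{ and } m,$$ where $$\varrho_h(z,\zeta)=\frac12\log\frac{1+\varrho_p(z,\zeta)}{1-\varrho_p(z,\zeta)},\qquad \varrho_p(z,\zeta)=\left|\frac{z-\zeta}{1-\overline{z}\,\zeta}\right|,$$ denotes the hyperbolic distance in $\mathbb D$. -/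

import Mathlib

/-- The open unit disc of the complex plane. -/
def unitDisc : Set ℂ := Metric.ball (0 : ℂ) 1

/-- The disc automorphism `φ_a(z) = (a - z) / (1 - conj a * z)`. -/
noncomputable def discAut (a z : ℂ) : ℂ := (a - z) / (1 - (starRingEnd ℂ) a * z)

/-- The pseudo-hyperbolic distance of two points of the unit disc. -/
noncomputable def pseudoHypDist (z₁ z₂ : ℂ) : ℝ := ‖discAut z₁ z₂‖

/-- The hyperbolic distance of two points of the unit disc. -/
noncomputable def hypDist (z₁ z₂ : ℂ) : ℝ :=
  1 / 2 * Real.log ((1 + pseudoHypDist z₁ z₂) / (1 - pseudoHypDist z₁ z₂))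

/-- `f` is an analytic solution of `f'' + A f = 0` in the unit disc. -/
def IsSolution (A f : ℂ → ℂ) : Prop :=
  AnalyticOnNhd ℂ f unitDisc ∧ ∀ z ∈ unitDisc, deriv (deriv f) z + A z * f z = 0

/-- The set of zeros of `f` in the unit disc. -/
def zerosInDisc (f : ℂ → ℂ) : Set ℂ := {z | z ∈ unitDisc ∧ f z = 0}

open Filter Topology Set

/-! The Wronskian is a nonzero constant `w`, so the quotient `f₁ / f₂` has spherical derivative `‖w‖
/ N`, where `N = ‖f₁‖ ^ 2 + ‖f₂‖ ^ 2`. At zeros of `f₁` and `f₂` the quotient takes the antipodal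
values 0 and ∞, so a lower bound on `N` forces such zeros apart.

The bound needed is `N z ≥ c * (1 - ‖z‖ ^ 2)` (`exists_mul_one_sub_sq_le_normSq_add`). For `z` near
the boundary, the combination `g = f₁ z • f₂ - f₂ z • f₁` vanishes at `z` with derivative `w`. In
hyperbolic arc length along the radius through `z`, the growth condition makes the equation an
integrable perturbation of `G'' = 0`. Sturm comparison (`sturm_norm_ge`) then carries the slope at
`z` back to a fixed circle, where `g` is at most a constant times `√(N z)`.

Integrating along the segment between two zeros (`le_norm_sub_of_zeros`) bounds their distance below
by a multiple of the smaller distance to the boundary, which is pseudo-hyperbolic separation. -/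

/-! ### Sturm comparison for vector-valued functions. -/

theorem tendsto_inv_smul_of_hasDerivAt_of_eq_zero {F : Type*} [NormedAddCommGroup F]
    [NormedSpace ℝ F] {h : ℝ → F} {h' : F} {b : ℝ} (hh : HasDerivAt h h' b) (hb : h b = 0) :
    Tendsto (fun t => (t - b)⁻¹ • h t) (𝓝[<] b) (𝓝 h') := by
  refine (hh.tendsto_slope.mono_left (nhdsWithin_mono _ fun x hx => ?_)).congr fun t => ?_
  · exact ne_of_lt hx
  · simp [slope_def_module, hb]

/-- Sturm comparison, backwards from a common zero. -/
theorem sturm_norm_ge {E : Type*} [NormedAddCommGroup E] [InnerProductSpace ℝ E]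
    {G G₁ G₂ : ℝ → E} {p p₁ p₂ : ℝ → ℝ} {a b : ℝ} (hab : a < b)
    (hG : ∀ t, HasDerivAt G (G₁ t) t) (hG₁ : ∀ t, HasDerivAt G₁ (G₂ t) t)
    (hp : ∀ t, HasDerivAt p (p₁ t) t) (hp₁ : ∀ t, HasDerivAt p₁ (p₂ t) t)
    (hGb : G b = 0) (hpb : p b = 0) (hp₁b : p₁ b ≠ 0)
    (hpos : ∀ t ∈ Ico a b, 0 < p t)
    (hcomp : ∀ t ∈ Ico a b, p₂ t * ‖G t‖ ^ 2 ≤ p t * inner ℝ (G t) (G₂ t)) :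
    (‖G₁ b‖ / |p₁ b|) ^ 2 ≤ (‖G a‖ / p a) ^ 2 := by
  -- `Q` is `p ^ 2` times the derivative of `‖G‖ ^ 2 / p ^ 2`. It increases to the limit 0 at `b`,
  -- hence is nonpositive, so `‖G‖ / p` decreases. Nothing is divided by `G`, which may vanish
  -- before `b`.
  set Q : ℝ → ℝ := fun t => 2 * inner ℝ (G t) (G₁ t) - 2 * (‖G t‖ ^ 2 * p₁ t / p t) with hQ
  have hGs := tendsto_inv_smul_of_hasDerivAt_of_eq_zero (hG b) hGb
  have hps := tendsto_inv_smul_of_hasDerivAt_of_eq_zero (hp b) hpb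
  have hGc : Tendsto G (𝓝[<] b) (𝓝 0) := by
    simpa [hGb] using (hG b).continuousAt.tendsto.mono_left nhdsWithin_le_nhds
  have hG₁c : Tendsto G₁ (𝓝[<] b) (𝓝 (G₁ b)) :=
    (hG₁ b).continuousAt.tendsto.mono_left nhdsWithin_le_nhds
  have hp₁c : Tendsto p₁ (𝓝[<] b) (𝓝 (p₁ b)) :=
    (hp₁ b).continuousAt.tendsto.mono_left nhdsWithin_le_nhds
  have hpc : Tendsto p (𝓝[<] b) (𝓝 0) := by
    simpa [hpb] using (hp b).continuousAt.tendsto.mono_left nhdsWithin_le_nhds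
  have hne : ∀ᶠ t in 𝓝[<] b, t - b ≠ 0 := by
    filter_upwards [self_mem_nhdsWithin] with t ht
    exact sub_ne_zero.2 (ne_of_lt ht)
  have hratio : Tendsto (fun t => ‖G t‖ / |p t|) (𝓝[<] b) (𝓝 (‖G₁ b‖ / |p₁ b|)) := by
    refine ((hGs.norm).div hps.abs (by simpa using hp₁b)).congr' ?_
    filter_upwards [hne] with t ht
    change ‖(t - b)⁻¹ • G t‖ / |(t - b)⁻¹ • p t| = _
    rw [norm_smul, smul_eq_mul, abs_mul, Real.norm_eq_abs]
    exact mul_div_mul_left _ _ (abs_ne_zero.2 (inv_ne_zero ht))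
  have hQlim : Tendsto Q (𝓝[<] b) (𝓝 0) := by
    have h1 : Tendsto (fun t => inner ℝ (G t) (G₁ t)) (𝓝[<] b) (𝓝 0) := by
      simpa using hGc.inner (𝕜 := ℝ) hG₁c
    have h2 : Tendsto (fun t => (‖G t‖ / |p t|) ^ 2 * (p₁ t * p t)) (𝓝[<] b) (𝓝 0) := by
      simpa using (hratio.pow 2).mul (hp₁c.mul hpc)
    have h3 := (h1.const_mul 2).sub (h2.const_mul 2)
    simp only [mul_zero, sub_zero] at h3
    refine h3.congr' ?_
    have : Ioo a b ∈ 𝓝[<] b := Ioo_mem_nhdsLT hab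
    filter_upwards [this] with t ht
    have hpt := hpos t ⟨ht.1.le, ht.2⟩
    simp only [hQ, abs_of_pos hpt]
    field_simp
  have hQd : ∀ t ∈ Ico a b, HasDerivAt Q (2 * (inner ℝ (G t) (G₂ t) + inner ℝ (G₁ t) (G₁ t)) -
      2 * (((2 * inner ℝ (G t) (G₁ t)) * p₁ t + ‖G t‖ ^ 2 * p₂ t) * p t -
        ‖G t‖ ^ 2 * p₁ t * p₁ t) / p t ^ 2) t := by
    intro t ht
    have h1 := ((hG t).inner ℝ (hG₁ t)).const_mul 2
    have h2 := ((((hG t).norm_sq).mul (hp₁ t)).div (hp t) (hpos t ht).ne').const_mul 2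
    refine (h1.sub h2).congr_deriv ?_
    simp only [mul_div_assoc]; rfl
  have hQd0 : ∀ t ∈ Ico a b, 0 ≤ deriv Q t := by
    intro t ht
    rw [(hQd t ht).deriv]
    have hpt := hpos t ht
    have hc := hcomp t ht
    -- Up to the factor `2 / p ^ 2`, the derivative of `Q` is this square plus `p` times the gap in
    -- `hcomp`.
    have hsq : 0 ≤ ‖p t • G₁ t - p₁ t • G t‖ ^ 2 := by positivity
    rw [norm_sub_sq_real, norm_smul, norm_smul, inner_smul_left, inner_smul_right,
      real_inner_comm, mul_pow, mul_pow, Real.norm_eq_abs, Real.norm_eq_abs, sq_abs, sq_abs] at hsq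
    simp only [conj_trivial] at hsq
    rw [real_inner_self_eq_norm_sq, sub_nonneg, div_le_iff₀ (by positivity)]
    nlinarith [mul_le_mul_of_nonneg_left hc hpt.le]
  have hQmono : MonotoneOn Q (Ico a b) := by
    refine monotoneOn_of_deriv_nonneg (convex_Ico a b)
      (fun t ht => (hQd t ht).continuousAt.continuousWithinAt)
      (fun t ht => (hQd t (interior_subset ht)).differentiableAt.differentiableWithinAt)
      (fun t ht => hQd0 t (interior_subset ht))
  have hev : ∀ t ∈ Ico a b, ∀ᶠ s in 𝓝[<] b, s ∈ Ico a b ∧ t ≤ s := by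
    intro t ht
    filter_upwards [Ioo_mem_nhdsLT ht.2] with s hs
    exact ⟨⟨ht.1.trans hs.1.le, hs.2⟩, hs.1.le⟩
  have hQ0 : ∀ t ∈ Ico a b, Q t ≤ 0 := fun t ht =>
    ge_of_tendsto hQlim ((hev t ht).mono fun s hs => hQmono ht hs.1 hs.2)
  have hMd : ∀ t ∈ Ico a b, HasDerivAt (fun t => ‖G t‖ ^ 2 / p t ^ 2) (Q t / p t ^ 2) t := by
    intro t ht
    have hpt := hpos t ht
    refine (((hG t).norm_sq).div ((hp t).pow 2) (pow_ne_zero 2 hpt.ne')).congr_deriv ?_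
    simp only [hQ]
    field_simp
    simp
    ring
  have hManti : AntitoneOn (fun t => ‖G t‖ ^ 2 / p t ^ 2) (Ico a b) := by
    refine antitoneOn_of_deriv_nonpos (convex_Ico a b)
      (fun t ht => (hMd t ht).continuousAt.continuousWithinAt)
      (fun t ht => (hMd t (interior_subset ht)).differentiableAt.differentiableWithinAt)
      (fun t ht => ?_)
    rw [(hMd t (interior_subset ht)).deriv]
    exact div_nonpos_of_nonpos_of_nonneg (hQ0 t (interior_subset ht)) (by positivity)
  have ha : a ∈ Ico a b := ⟨le_rfl, hab⟩
  refine le_of_tendsto (hratio.pow 2) ((hev a ha).mono fun s hs => ?_)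
  have := hManti ha hs.1 hs.2
  simpa [div_pow] using this

/-! ### The disc and the solution space. -/

theorem mem_unitDisc {z : ℂ} : z ∈ unitDisc ↔ ‖z‖ < 1 := by simp [unitDisc]

theorem isOpen_unitDisc : IsOpen unitDisc := Metric.isOpen_ball

theorem convex_unitDisc : Convex ℝ unitDisc := convex_ball 0 1

theorem IsSolution.hasDerivAt {A f : ℂ → ℂ} (hf : IsSolution A f) {z : ℂ} (hz : z ∈ unitDisc) :
    HasDerivAt f (deriv f z) z :=
  (hf.1 z hz).differentiableAt.hasDerivAt

theorem IsSolution.hasDerivAt_deriv {A f : ℂ → ℂ} (hf : IsSolution A f) {z : ℂ}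
    (hz : z ∈ unitDisc) : HasDerivAt (deriv f) (-(A z * f z)) z := by
  rw [← eq_neg_of_add_eq_zero_left (hf.2 z hz)]
  exact (hf.1 z hz).deriv.differentiableAt.hasDerivAt

theorem IsSolution.linearCombination {A f₁ f₂ : ℂ → ℂ} (hf₁ : IsSolution A f₁)
    (hf₂ : IsSolution A f₂) (α β : ℂ) : IsSolution A (fun z => α * f₁ z + β * f₂ z) := by
  refine ⟨fun z hz => (analyticAt_const.mul (hf₁.1 z hz)).add (analyticAt_const.mul (hf₂.1 z hz)),
    fun z hz => ?_⟩
  have h : deriv (fun z => α * f₁ z + β * f₂ z) =ᶠ[𝓝 z]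
      fun z => α * deriv f₁ z + β * deriv f₂ z := by
    filter_upwards [isOpen_unitDisc.mem_nhds hz] with x hx
    exact (((hf₁.hasDerivAt hx).const_mul α).add ((hf₂.hasDerivAt hx).const_mul β)).deriv
  rw [h.deriv_eq, (((hf₁.hasDerivAt_deriv hz).const_mul α).fun_add
    ((hf₂.hasDerivAt_deriv hz).const_mul β)).deriv]
  ring

/-! ### The equation along a radius in hyperbolic arc length. -/

theorem Real.hasDerivAt_tanh_one_div_cosh_sq (t : ℝ) : HasDerivAt Real.tanh (1 / Real.cosh t ^ 2) t := by
  have hc := (Real.cosh_pos t).ne'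
  have h := (Real.hasDerivAt_sinh t).div (Real.hasDerivAt_cosh t) hc
  have e : Real.sinh / Real.cosh = Real.tanh := funext fun x => (Real.tanh_eq_sinh_div_cosh x).symm
  rw [e] at h
  refine h.congr_deriv ?_
  rw [← Real.cosh_sq_sub_sinh_sq t]
  ring

theorem Real.one_sub_tanh_sq (t : ℝ) : 1 - Real.tanh t ^ 2 = 1 / Real.cosh t ^ 2 := by
  have hc := (Real.cosh_pos t).ne'
  rw [Real.tanh_eq_sinh_div_cosh]
  field_simp
  exact Real.cosh_sq_sub_sinh_sq t

theorem Real.one_sub_tanh_le (t : ℝ) : 1 - Real.tanh t ≤ 2 * Real.exp (-2 * t) := by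
  have hc := Real.cosh_pos t
  have h1 : 1 - Real.tanh t = Real.exp (-t) / Real.cosh t := by
    rw [Real.tanh_eq_sinh_div_cosh, ← Real.cosh_sub_sinh]
    field_simp
  have h2 : Real.exp (-2 * t) = Real.exp (-t) * Real.exp (-t) := by
    rw [← Real.exp_add]; ring_nf
  have h3 : Real.exp (-t) * Real.exp t = 1 := by rw [← Real.exp_add]; simp
  rw [h1, h2, div_le_iff₀ hc, Real.cosh_eq]
  have := Real.exp_pos (-t)
  nlinarith [mul_pos this (mul_pos this this)]

/-- The radial point of the disc at hyperbolic distance `|t|` from the origin. -/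
noncomputable def radialPoint (u : ℂ) (t : ℝ) : ℂ := (Real.tanh t : ℂ) * u

theorem norm_radialPoint {u : ℂ} (hu : ‖u‖ = 1) (t : ℝ) : ‖radialPoint u t‖ = |Real.tanh t| := by
  rw [radialPoint, norm_mul, hu, mul_one, Complex.norm_real, Real.norm_eq_abs]

theorem radialPoint_mem {u : ℂ} (hu : ‖u‖ = 1) (t : ℝ) : radialPoint u t ∈ unitDisc := by
  rw [mem_unitDisc, norm_radialPoint hu]
  exact Real.abs_tanh_lt_one t

theorem hasDerivAt_radialPoint (u : ℂ) (t : ℝ) :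
    HasDerivAt (radialPoint u) (((1 / Real.cosh t ^ 2 : ℝ) : ℂ) * u) t :=
  (Real.hasDerivAt_tanh_one_div_cosh_sq t).ofReal_comp.mul_const u

/-- The factor `cosh` is the Liouville normalisation `r' ^ (-1/2)` for `r = tanh t`: it removes the
first-order term that the change of variable creates. -/
theorem hasDerivAt_cosh_mul_comp_radialPoint {A g : ℂ → ℂ} (hg : IsSolution A g) {u : ℂ}
    (hu : ‖u‖ = 1) (t : ℝ) :
    HasDerivAt (fun t : ℝ => (Real.cosh t : ℂ) * g (radialPoint u t))
      ((Real.sinh t : ℂ) * g (radialPoint u t) +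
        ((Real.cosh t)⁻¹ : ℝ) * (u * deriv g (radialPoint u t))) t := by
  have h1 := (hg.hasDerivAt (radialPoint_mem hu t)).comp t (hasDerivAt_radialPoint u t)
  refine ((Real.hasDerivAt_cosh t).ofReal_comp.mul h1).congr_deriv ?_
  have hc : (Real.cosh t : ℂ) ≠ 0 := by exact_mod_cast (Real.cosh_pos t).ne'
  push_cast at hc ⊢
  simp only [Function.comp]
  field_simp

theorem hasDerivAt_deriv_cosh_mul_comp_radialPoint {A g : ℂ → ℂ} (hg : IsSolution A g) {u : ℂ}
    (hu : ‖u‖ = 1) (t : ℝ) :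
    HasDerivAt (fun t : ℝ => (Real.sinh t : ℂ) * g (radialPoint u t) +
        ((Real.cosh t)⁻¹ : ℝ) * (u * deriv g (radialPoint u t)))
      ((1 - u ^ 2 * A (radialPoint u t) * ((1 / Real.cosh t ^ 2 : ℝ) : ℂ) ^ 2) *
        ((Real.cosh t : ℂ) * g (radialPoint u t))) t := by
  have h1 := (hg.hasDerivAt (radialPoint_mem hu t)).comp t (hasDerivAt_radialPoint u t)
  have h2 := (hg.hasDerivAt_deriv (radialPoint_mem hu t)).comp t (hasDerivAt_radialPoint u t)
  have h3 := ((Real.hasDerivAt_cosh t).inv (Real.cosh_pos t).ne').ofReal_comp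
  refine (((Real.hasDerivAt_sinh t).ofReal_comp.mul h1).add
    (h3.mul (h2.const_mul u))).congr_deriv ?_
  have hc : (Real.cosh t : ℂ) ≠ 0 := by exact_mod_cast (Real.cosh_pos t).ne'
  push_cast at hc ⊢
  simp only [Function.comp, Pi.inv_apply]
  push_cast
  field_simp
  ring

theorem half_mul_exp_le {C t : ℝ} (ht : C ≤ t) :
    C / 2 * Real.exp (-2 * t) ≤ 1 / 2 := by
  have h1 : 2 * t + 1 ≤ Real.exp (2 * t) := Real.add_one_le_exp _
  have h2 : Real.exp (-2 * t) * Real.exp (2 * t) = 1 := by rw [← Real.exp_add]; simp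
  have h3 := Real.exp_pos (-2 * t)
  nlinarith [mul_le_mul_of_nonneg_left h1 h3.le, mul_le_mul_of_nonneg_left ht h3.le]

/-- A solution vanishing at a point near the boundary is not small at the point on the same radius
at hyperbolic distance `C` from the origin. -/
theorem IsSolution.norm_deriv_le_of_eq_zero {A g : ℂ → ℂ} {C : ℝ} (hC : 0 < C)
    (hbound : ∀ z ∈ unitDisc, ‖A z‖ * (1 - ‖z‖ ^ 2) ^ 2 ≤ 1 + C * (1 - ‖z‖))
    (hg : IsSolution A g) {u : ℂ} (hu : ‖u‖ = 1) {s : ℝ} (hs : C + 1 ≤ s)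
    (h0 : g (radialPoint u s) = 0) :
    ‖deriv g (radialPoint u s)‖ / Real.cosh s ≤
      2 * Real.cosh C * ‖g (radialPoint u C)‖ := by
  set e : ℝ → ℝ := fun t => Real.exp (-2 * t) with he
  have hed : ∀ t, HasDerivAt e (-2 * e t) t := fun t => by
    have := ((hasDerivAt_id t).const_mul (-2)).exp
    simpa [he, mul_comm] using this
  have hepos : ∀ t, 0 < e t := fun t => Real.exp_pos _
  have heC : ∀ t, C ≤ t → C / 2 * e t ≤ 1 / 2 := fun t ht => half_mul_exp_le ht
  -- The unperturbed comparison function is `s - t`. The correcting factor, which lies in `[1/2, 1]`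
  -- for `t ≥ C`, gives `p'' ≤ -2 * C * e * p`, matching the bound `‖B‖ ≤ 1 + 2 * C * e` for the
  -- potential.
  have key := sturm_norm_ge (a := C) (b := s)
    (p := fun t => (s - t) * (1 - C / 2 * e t))
    (p₁ := fun t => -(1 - C / 2 * e t) + (s - t) * (C * e t))
    (p₂ := fun t => -2 * (C * e t) - (s - t) * (2 * C * e t))
    (by linarith)
    (fun t => hasDerivAt_cosh_mul_comp_radialPoint hg hu t)
    (fun t => hasDerivAt_deriv_cosh_mul_comp_radialPoint hg hu t)
    (fun t => by
      refine (((hasDerivAt_id t).const_sub s).mul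
        (((hed t).const_mul (C / 2)).const_sub 1)).congr_deriv ?_
      simp only [id]
      ring)
    (fun t => by
      refine ((((hed t).const_mul (C / 2)).const_sub 1).neg.add
        (((hasDerivAt_id t).const_sub s).mul ((hed t).const_mul C))).congr_deriv ?_
      simp only [id]
      ring)
    (by simp [h0]) (by simp)
    (by have := heC s (by linarith); simp; intro h; linarith)
    (fun t ht => mul_pos (by linarith [ht.2]) (by linarith [heC t ht.1]))
    (fun t ht => by
      have hA := hbound _ (radialPoint_mem hu t)
      rw [norm_radialPoint hu, sq_abs, Real.one_sub_tanh_sq] at hA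
      have htanh := Real.one_sub_tanh_le t
      set G := (Real.cosh t : ℂ) * g (radialPoint u t)
      set B := u ^ 2 * A (radialPoint u t) * ((1 / Real.cosh t ^ 2 : ℝ) : ℂ) ^ 2 with hB
      have hBn : ‖B‖ ≤ 1 + 2 * C * e t := by
        have : ‖B‖ = ‖A (radialPoint u t)‖ * (1 / Real.cosh t ^ 2) ^ 2 := by
          rw [hB, norm_mul, norm_mul, norm_pow, norm_pow, hu, one_pow, one_mul, Complex.norm_real,
            Real.norm_eq_abs, sq_abs]
        rw [this]
        nlinarith [mul_le_mul_of_nonneg_left (le_abs_self (Real.tanh t)) hC.le]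
      have hin : inner ℝ G ((1 - B) * G) = (1 - B.re) * ‖G‖ ^ 2 := by
        rw [Complex.inner, ← Complex.normSq_eq_norm_sq, Complex.normSq_apply]
        simp
        ring
      have hre : -(2 * C * e t) ≤ 1 - B.re := by linarith [Complex.re_le_norm B]
      rw [hin, ← mul_assoc _ _ (‖G‖ ^ 2)]
      refine mul_le_mul_of_nonneg_right ?_ (sq_nonneg _)
      have h1 : 0 ≤ s - t := by linarith [ht.2]
      have h2 := heC t ht.1
      have h3 := hepos t
      have h4 : 0 ≤ (s - t) * (1 - C / 2 * e t) := mul_nonneg h1 (by linarith)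
      have h5 : 0 ≤ C * e t := by positivity
      nlinarith [mul_le_mul_of_nonneg_left hre h4, mul_nonneg (mul_nonneg h1 h5) h5])
  have hsC := heC s (by linarith)
  have hCC := heC C le_rfl
  have hes := hepos s
  -- Here `C + 1 ≤ s` matters: the first factor is at least 1, the second at least 1/2.
  have hpC : 1 / 2 ≤ (s - C) * (1 - C / 2 * e C) := by nlinarith
  have key' := (pow_le_pow_iff_left₀ (by positivity)
    (div_nonneg (norm_nonneg _) (by linarith)) two_ne_zero).1 key
  have hcs := Real.cosh_pos s
  have hcC := Real.cosh_pos C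
  have habs : |-(1 - C / 2 * e s) + (s - s) * (C * e s)| = 1 - C / 2 * e s := by
    rw [sub_self, zero_mul, add_zero, abs_neg, abs_of_pos (by linarith)]
  rw [h0, mul_zero, zero_add, norm_mul, norm_mul, norm_mul, hu, one_mul, Complex.norm_real,
    Complex.norm_real, Real.norm_of_nonneg (inv_nonneg.2 hcs.le), Real.norm_of_nonneg hcC.le,
    habs] at key'
  calc ‖deriv g (radialPoint u s)‖ / Real.cosh s
      = (Real.cosh s)⁻¹ * ‖deriv g (radialPoint u s)‖ := by rw [div_eq_inv_mul]
    _ ≤ (Real.cosh s)⁻¹ * ‖deriv g (radialPoint u s)‖ / (1 - C / 2 * e s) :=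
      le_div_self (by positivity) (by linarith) (by nlinarith)
    _ ≤ Real.cosh C * ‖g (radialPoint u C)‖ / ((s - C) * (1 - C / 2 * e C)) := key'
    _ ≤ Real.cosh C * ‖g (radialPoint u C)‖ / (1 / 2) := by gcongr
    _ = 2 * Real.cosh C * ‖g (radialPoint u C)‖ := by ring

/-! ### Lower bound for a fundamental system; the Wronskian. -/

theorem norm_mul_sub_mul_sq_le (a b c d : ℂ) :
    ‖a * d - b * c‖ ^ 2 ≤ (‖a‖ ^ 2 + ‖b‖ ^ 2) * (‖c‖ ^ 2 + ‖d‖ ^ 2) := by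
  have h := norm_sub_le (a * d) (b * c)
  rw [norm_mul, norm_mul] at h
  have h2 := pow_le_pow_left₀ (norm_nonneg _) h 2
  nlinarith [sq_nonneg (‖a‖ * ‖c‖ - ‖b‖ * ‖d‖)]

/-- Under the Nehari type growth condition, a fundamental system decays at most like
`(1 - ‖z‖ ^ 2) ^ (1 / 2)` at the boundary. -/
theorem exists_mul_one_sub_sq_le_normSq_add {A f₁ f₂ : ℂ → ℂ} {C : ℝ} (hC : 0 < C)
    (hbound : ∀ z ∈ unitDisc, ‖A z‖ * (1 - ‖z‖ ^ 2) ^ 2 ≤ 1 + C * (1 - ‖z‖))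
    (hf₁ : IsSolution A f₁) (hf₂ : IsSolution A f₂) {w : ℂ} (hw : w ≠ 0)
    (hW : ∀ z ∈ unitDisc, f₁ z * deriv f₂ z - f₂ z * deriv f₁ z = w) :
    ∃ c : ℝ, 0 < c ∧ ∀ z ∈ unitDisc, c * (1 - ‖z‖ ^ 2) ≤ ‖f₁ z‖ ^ 2 + ‖f₂ z‖ ^ 2 := by
  -- Outside this radius the hyperbolic distance to the origin exceeds `C + 1`, as the comparison
  -- requires; inside it, compactness suffices.
  set R := Real.tanh (C + 1)
  set N : ℂ → ℝ := fun z => ‖f₁ z‖ ^ 2 + ‖f₂ z‖ ^ 2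
  have hR : ∀ z ∈ Metric.closedBall (0 : ℂ) R, z ∈ unitDisc := fun z hz => by
    rw [mem_closedBall_zero_iff] at hz
    exact mem_unitDisc.2 (hz.trans_lt (Real.tanh_lt_one _))
  have hR0 : 0 < R := by
    have := Real.one_sub_tanh_le (C + 1)
    have h2 : 2 * (C + 1) + 1 ≤ Real.exp (2 * (C + 1)) := Real.add_one_le_exp _
    have h3 : Real.exp (-2 * (C + 1)) * Real.exp (2 * (C + 1)) = 1 := by
      rw [← Real.exp_add]; simp
    nlinarith [Real.exp_pos (-2 * (C + 1))]
  have hNc : ContinuousOn N (Metric.closedBall 0 R) := fun z hz =>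
    (((hf₁.hasDerivAt (hR z hz)).continuousAt.norm.pow 2).add
      ((hf₂.hasDerivAt (hR z hz)).continuousAt.norm.pow 2)).continuousWithinAt
  have hNpos : ∀ z ∈ unitDisc, 0 < N z := fun z hz => by
    refine lt_of_le_of_ne (by positivity) fun h => hw ?_
    have h1 : ‖f₁ z‖ ^ 2 = 0 := by linarith [sq_nonneg ‖f₁ z‖, sq_nonneg ‖f₂ z‖, h]
    have h2 : ‖f₂ z‖ ^ 2 = 0 := by linarith [sq_nonneg ‖f₁ z‖, sq_nonneg ‖f₂ z‖, h]
    rw [← hW z hz, norm_eq_zero.1 (pow_eq_zero_iff two_ne_zero |>.1 h1),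
      norm_eq_zero.1 (pow_eq_zero_iff two_ne_zero |>.1 h2)]
    ring
  have hK : IsCompact (Metric.closedBall (0 : ℂ) R) := isCompact_closedBall 0 R
  have hKne : (Metric.closedBall (0 : ℂ) R).Nonempty := ⟨0, by simpa using hR0.le⟩
  obtain ⟨x, hx, hmin⟩ := hK.exists_isMinOn hKne hNc
  obtain ⟨y, hy, hmax⟩ := hK.exists_isMaxOn hKne hNc
  have hxp := hNpos x (hR x hx)
  have hyp := hNpos y (hR y hy)
  have hcC := Real.cosh_pos C
  have hwp : 0 < ‖w‖ := norm_pos_iff.2 hw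
  have hD : 0 < 4 * Real.cosh C ^ 2 * N y := by positivity
  refine ⟨min (N x) (‖w‖ ^ 2 / (4 * Real.cosh C ^ 2 * N y)), by positivity, fun z hz => ?_⟩
  have hz1 : ‖z‖ < 1 := mem_unitDisc.1 hz
  have h1z : 0 ≤ 1 - ‖z‖ ^ 2 := by nlinarith [norm_nonneg z]
  rcases le_or_gt ‖z‖ R with hzR | hzR
  · calc _ ≤ N x * (1 - ‖z‖ ^ 2) := mul_le_mul_of_nonneg_right (min_le_left _ _) h1z
      _ ≤ N x := by nlinarith [sq_nonneg ‖z‖]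
      _ ≤ N z := hmin (mem_closedBall_zero_iff.2 hzR)
  · refine (mul_le_mul_of_nonneg_right (min_le_right _ _) h1z).trans ?_
    rw [div_mul_eq_mul_div, div_le_iff₀ hD]
    have hz0 : ‖z‖ ≠ 0 := (hR0.trans hzR).ne'
    set s := Real.artanh ‖z‖
    set u : ℂ := z / (‖z‖ : ℂ)
    have hzI : ‖z‖ ∈ Ioo (-1 : ℝ) 1 := ⟨by linarith [norm_nonneg z], hz1⟩
    have hts : Real.tanh s = ‖z‖ := Real.tanh_artanh hzI
    have hu : ‖u‖ = 1 := by simp [u, hz0]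
    have huz : radialPoint u s = z := by
      have : (‖z‖ : ℂ) ≠ 0 := by exact_mod_cast hz0
      rw [radialPoint, hts, mul_div_cancel₀ _ this]
    have hs : C + 1 ≤ s := by
      rw [← Real.artanh_tanh (C + 1)]
      exact Real.artanh_le_artanh (Real.neg_one_lt_tanh _) hz1 hzR.le
    -- This combination vanishes at `z`, and its derivative there is the Wronskian.
    have hg := hf₁.linearCombination hf₂ (-f₂ z) (f₁ z)
    have hgd : deriv (fun x => -f₂ z * f₁ x + f₁ z * f₂ x) z = w := by
      rw [(((hf₁.hasDerivAt hz).const_mul _).fun_add ((hf₂.hasDerivAt hz).const_mul _)).deriv,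
        ← hW z hz]
      ring
    have key := hg.norm_deriv_le_of_eq_zero hC hbound hu hs (by rw [huz]; ring)
    rw [huz, hgd] at key
    set zC := radialPoint u C
    have hzC : N zC ≤ N y := by
      refine hmax (mem_closedBall_zero_iff.2 ?_)
      rw [norm_radialPoint hu, abs_le]
      have hmono : Real.tanh C ≤ R := by
        rw [← Real.artanh_le_artanh_iff ⟨Real.neg_one_lt_tanh _, Real.tanh_lt_one _⟩
          ⟨Real.neg_one_lt_tanh _, Real.tanh_lt_one _⟩, Real.artanh_tanh, Real.artanh_tanh]
        linarith
      have hmono' : -Real.tanh C ≤ R := by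
        rw [← Real.tanh_neg, ← Real.artanh_le_artanh_iff
          ⟨Real.neg_one_lt_tanh _, Real.tanh_lt_one _⟩
          ⟨Real.neg_one_lt_tanh _, Real.tanh_lt_one _⟩, Real.artanh_tanh, Real.artanh_tanh]
        linarith
      exact ⟨by linarith, hmono⟩
    have hcs : 1 / Real.cosh s ^ 2 = 1 - ‖z‖ ^ 2 := by rw [← Real.one_sub_tanh_sq, hts]
    have key2 := pow_le_pow_left₀ (by positivity) key 2
    have hCS := norm_mul_sub_mul_sq_le (f₁ z) (f₂ z) (f₁ zC) (f₂ zC)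
    have heq : -f₂ z * f₁ zC + f₁ z * f₂ zC = f₁ z * f₂ zC - f₂ z * f₁ zC := by ring
    calc ‖w‖ ^ 2 * (1 - ‖z‖ ^ 2) = (‖w‖ / Real.cosh s) ^ 2 := by rw [← hcs]; ring
      _ ≤ (2 * Real.cosh C * ‖f₁ z * f₂ zC - f₂ z * f₁ zC‖) ^ 2 := heq ▸ key2
      _ = 4 * Real.cosh C ^ 2 * ‖f₁ z * f₂ zC - f₂ z * f₁ zC‖ ^ 2 := by ring
      _ ≤ 4 * Real.cosh C ^ 2 * (N z * N y) := by
        refine mul_le_mul_of_nonneg_left (hCS.trans ?_) (by positivity)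
        exact mul_le_mul_of_nonneg_left hzC (hNpos z hz).le
      _ = N z * (4 * Real.cosh C ^ 2 * N y) := by ring

/-- The Wronskian of two linearly independent solutions is a nonzero constant. -/
theorem exists_wronskian_eq {A f₁ f₂ : ℂ → ℂ} (hf₁ : IsSolution A f₁) (hf₂ : IsSolution A f₂)
    (hind : LinearIndependent ℂ ![unitDisc.domRestrict f₁, unitDisc.domRestrict f₂]) :
    ∃ w : ℂ, w ≠ 0 ∧ ∀ z ∈ unitDisc, f₁ z * deriv f₂ z - f₂ z * deriv f₁ z = w := by
  have hd : ∀ z ∈ unitDisc, HasDerivAt (fun z => f₁ z * deriv f₂ z - f₂ z * deriv f₁ z) 0 z := by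
    intro z hz
    refine (((hf₁.hasDerivAt hz).mul (hf₂.hasDerivAt_deriv hz)).fun_sub
      ((hf₂.hasDerivAt hz).mul (hf₁.hasDerivAt_deriv hz))).congr_deriv ?_
    ring
  have hpre : IsPreconnected unitDisc := convex_unitDisc.isPreconnected
  obtain ⟨w, hw⟩ := isOpen_unitDisc.exists_is_const_of_deriv_eq_zero hpre
    (fun z hz => (hd z hz).differentiableAt.differentiableWithinAt) (fun z hz => (hd z hz).deriv)
  refine ⟨w, fun hw0 => ?_, hw⟩
  subst hw0
  rw [LinearIndependent.pair_iff] at hind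
  have hne : ∃ z₀ ∈ unitDisc, f₂ z₀ ≠ 0 := by
    by_contra! h
    have := hind 0 1 (by ext x; simpa using h x x.2)
    exact one_ne_zero this.2
  obtain ⟨z₀, hz₀, h₀⟩ := hne
  have hev : ∀ᶠ z in 𝓝 z₀, z ∈ unitDisc ∧ f₂ z ≠ 0 :=
    (isOpen_unitDisc.eventually_mem hz₀).and ((hf₂.hasDerivAt hz₀).continuousAt.eventually_ne h₀)
  obtain ⟨r, hr, hball⟩ := Metric.eventually_nhds_iff_ball.1 hev
  -- A zero Wronskian makes `f₁ / f₂` locally constant; the identity theorem spreads the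
  -- proportionality over the disc, contradicting independence.
  have hqd : ∀ z ∈ Metric.ball z₀ r, HasDerivAt (fun z => f₁ z / f₂ z) 0 z := by
    intro z hz
    obtain ⟨hz1, hz2⟩ := hball z hz
    refine ((hf₁.hasDerivAt hz1).fun_div (hf₂.hasDerivAt hz1) hz2).congr_deriv ?_
    rw [div_eq_zero_iff]
    left
    linear_combination -hw z hz1
  obtain ⟨a, ha⟩ := Metric.isOpen_ball.exists_is_const_of_deriv_eq_zero
    (convex_ball z₀ r).isPreconnected
    (fun z hz => (hqd z hz).differentiableAt.differentiableWithinAt)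
    (fun z hz => (hqd z hz).deriv)
  have heq : f₁ =ᶠ[𝓝 z₀] fun z => a * f₂ z := by
    filter_upwards [Metric.ball_mem_nhds z₀ hr] with z hz
    rw [← ha z hz, div_mul_cancel₀ _ (hball z hz).2]
  have hall := hf₁.1.eqOn_of_preconnected_of_eventuallyEq
    (fun z hz => analyticAt_const.mul (hf₂.1 z hz)) hpre hz₀ heq
  have := hind 1 (-a) (by
    ext x
    simpa [sub_eq_add_neg] using sub_eq_zero.2 (hall x.2))
  exact one_ne_zero this.1

/-! ### Pseudo-hyperbolic estimates and separation of zeros. -/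

theorem one_sub_conj_mul_ne_zero {z ζ : ℂ} (hz : ‖z‖ < 1) (hζ : ‖ζ‖ < 1) :
    1 - (starRingEnd ℂ) z * ζ ≠ 0 := by
  intro h
  have h1 : ‖(starRingEnd ℂ) z * ζ‖ = 1 := by rw [← sub_eq_zero.1 h, norm_one]
  rw [norm_mul, RCLike.norm_conj] at h1
  nlinarith [norm_nonneg z, norm_nonneg ζ]

theorem pseudoHypDist_lt_one {z ζ : ℂ} (hz : ‖z‖ < 1) (hζ : ‖ζ‖ < 1) : pseudoHypDist z ζ < 1 := by
  have hne := norm_pos_iff.2 (one_sub_conj_mul_ne_zero hz hζ)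
  rw [pseudoHypDist, discAut, norm_div, div_lt_one hne]
  refine lt_of_pow_lt_pow_left₀ 2 hne.le ?_
  have h : ‖1 - (starRingEnd ℂ) z * ζ‖ ^ 2 - ‖z - ζ‖ ^ 2 = (1 - ‖z‖ ^ 2) * (1 - ‖ζ‖ ^ 2) := by
    simp only [← Complex.normSq_eq_norm_sq, Complex.normSq_apply]
    simp
    ring
  have : 0 < (1 - ‖z‖ ^ 2) * (1 - ‖ζ‖ ^ 2) := by
    apply mul_pos <;> nlinarith [norm_nonneg z, norm_nonneg ζ]
  linarith

theorem half_pseudoHypDist_le_hypDist {z ζ : ℂ} (hz : ‖z‖ < 1) (hζ : ‖ζ‖ < 1) :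
    pseudoHypDist z ζ / 2 ≤ hypDist z ζ := by
  have h1 := pseudoHypDist_lt_one hz hζ
  have h0 : 0 ≤ pseudoHypDist z ζ := norm_nonneg _
  rw [hypDist]
  set x := pseudoHypDist z ζ
  have hx : 0 < 1 - x := by linarith
  rw [Real.log_div (by linarith) hx.ne']
  have h2 := Real.log_le_sub_one_of_pos hx
  have h3 := Real.log_nonneg (by linarith : 1 ≤ 1 + x)
  linarith

theorem norm_one_sub_conj_mul_le (z ζ : ℂ) (hz : ‖z‖ < 1) (hζ : ‖ζ‖ < 1) :
    ‖1 - (starRingEnd ℂ) z * ζ‖ ≤ 2 * min (1 - ‖z‖) (1 - ‖ζ‖) + ‖ζ - z‖ := by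
  have aux : ∀ a b : ℂ, ‖a‖ < 1 → ‖b‖ < 1 →
      ‖1 - (starRingEnd ℂ) a * b‖ ≤ 2 * (1 - ‖a‖) + ‖b - a‖ := by
    intro a b ha hb
    have h : 1 - (starRingEnd ℂ) a * b =
        ((1 - ‖a‖ ^ 2 : ℝ) : ℂ) - (starRingEnd ℂ) a * (b - a) := by
      push_cast
      rw [mul_sub, ← Complex.conj_mul']
      ring
    have h1 : 0 ≤ 1 - ‖a‖ ^ 2 := by nlinarith [norm_nonneg a]
    calc _ ≤ (1 - ‖a‖ ^ 2) + ‖a‖ * ‖b - a‖ := by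
          rw [h]
          refine (norm_sub_le _ _).trans ?_
          rw [Complex.norm_real, Real.norm_of_nonneg h1, norm_mul, RCLike.norm_conj]
      _ ≤ _ := by nlinarith [norm_nonneg a, norm_nonneg (b - a)]
  rcases min_cases (1 - ‖z‖) (1 - ‖ζ‖) with ⟨h, -⟩ | ⟨h, -⟩ <;> rw [h]
  · exact aux z ζ hz hζ
  · rw [← RCLike.norm_conj, norm_sub_rev ζ z]
    simpa [mul_comm] using aux ζ z hζ hz

/-- Along the segment from `z` to `ζ`, the quantity `‖f₁‖ ^ 2 / N`, a height of `f₁ / f₂` on the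
Riemann sphere, rises from 0 to 1. By convexity the segment stays at distance at least `m` from the
unit circle, so `N ≥ c * m` there and the speed is at most `‖w‖ * ‖ζ - z‖ / (c * m)`. -/
theorem le_norm_sub_of_zeros {A f₁ f₂ : ℂ → ℂ} (hf₁ : IsSolution A f₁) (hf₂ : IsSolution A f₂)
    {w : ℂ} (hw : w ≠ 0) (hW : ∀ z ∈ unitDisc, f₁ z * deriv f₂ z - f₂ z * deriv f₁ z = w)
    {c : ℝ} (hc : 0 < c)
    (hlow : ∀ z ∈ unitDisc, c * (1 - ‖z‖ ^ 2) ≤ ‖f₁ z‖ ^ 2 + ‖f₂ z‖ ^ 2)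
    {z ζ : ℂ} (hz : z ∈ zerosInDisc f₁) (hζ : ζ ∈ zerosInDisc f₂) :
    min (1 - ‖z‖) (1 - ‖ζ‖) ≤ ‖w‖ / c * ‖ζ - z‖ := by
  obtain ⟨hzD, hz0⟩ := hz
  obtain ⟨hζD, hζ0⟩ := hζ
  set m := min (1 - ‖z‖) (1 - ‖ζ‖) with hm
  have hm0 : 0 < m := lt_min (by linarith [mem_unitDisc.1 hzD]) (by linarith [mem_unitDisc.1 hζD])
  have hmem : ∀ t ∈ Icc (0 : ℝ) 1, ‖z + (t : ℂ) * (ζ - z)‖ ≤ 1 - m := by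
    intro t ht
    have hconv := (convex_closedBall (0 : ℂ) (1 - m)).add_smul_sub_mem (x := z) (y := ζ)
      (mem_closedBall_zero_iff.2 (by linarith [min_le_left (1 - ‖z‖) (1 - ‖ζ‖)]))
      (mem_closedBall_zero_iff.2 (by linarith [min_le_right (1 - ‖z‖) (1 - ‖ζ‖)])) ht
    simpa using hconv
  have hD : ∀ t ∈ Icc (0 : ℝ) 1, z + (t : ℂ) * (ζ - z) ∈ unitDisc := fun t ht =>
    mem_unitDisc.2 ((hmem t ht).trans_lt (by linarith))
  have hγ : ∀ t : ℝ, HasDerivAt (fun t : ℝ => z + (t : ℂ) * (ζ - z)) (ζ - z) t := fun t => by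
    simpa using ((hasDerivAt_id t).ofReal_comp.mul_const (ζ - z)).const_add z
  set S : ℝ → ℝ := fun t => ‖f₁ (z + (t : ℂ) * (ζ - z))‖ ^ 2 /
    (‖f₁ (z + (t : ℂ) * (ζ - z))‖ ^ 2 + ‖f₂ (z + (t : ℂ) * (ζ - z))‖ ^ 2) with hS
  have hSd : ∀ t ∈ Icc (0 : ℝ) 1, ∃ d, HasDerivAt S d t ∧ ‖d‖ ≤ ‖w‖ / c * ‖ζ - z‖ / m := by
    intro t ht
    have hx := hD t ht
    have hxm := hmem t ht
    have h1 := ((hf₁.hasDerivAt hx).comp t (hγ t)).norm_sq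
    have h2 := ((hf₂.hasDerivAt hx).comp t (hγ t)).norm_sq
    have hl := hlow _ hx
    have hw' := hW _ hx
    simp only [Function.comp] at h1 h2
    set x := z + (t : ℂ) * (ζ - z)
    have hmN : c * m ≤ ‖f₁ x‖ ^ 2 + ‖f₂ x‖ ^ 2 := by
      refine le_trans (mul_le_mul_of_nonneg_left ?_ hc.le) hl
      nlinarith [norm_nonneg x]
    have hN0 : 0 < ‖f₁ x‖ ^ 2 + ‖f₂ x‖ ^ 2 := (mul_pos hc hm0).trans_le hmN
    refine ⟨_, h1.fun_div (h1.fun_add h2) hN0.ne', ?_⟩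
    -- The numerator of the quotient rule collapses to the Wronskian; `2 * ‖f₁‖ * ‖f₂‖ ≤ N` then
    -- cancels one power of `N`.
    have hnum : 2 * inner ℝ (f₁ x) (deriv f₁ x * (ζ - z)) * (‖f₁ x‖ ^ 2 + ‖f₂ x‖ ^ 2) -
        ‖f₁ x‖ ^ 2 * (2 * inner ℝ (f₁ x) (deriv f₁ x * (ζ - z)) +
          2 * inner ℝ (f₂ x) (deriv f₂ x * (ζ - z))) =
        -2 * ((starRingEnd ℂ) (f₁ x) * (starRingEnd ℂ) (f₂ x) * (w * (ζ - z))).re := by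
      rw [← hw']
      simp only [Complex.inner, ← Complex.normSq_eq_norm_sq, Complex.normSq_apply]
      simp
      ring
    rw [hnum, norm_div, Real.norm_of_nonneg (sq_nonneg (_ + _)), norm_mul, norm_neg,
      div_le_div_iff₀ (by positivity) hm0]
    have hre := Complex.abs_re_le_norm
      ((starRingEnd ℂ) (f₁ x) * (starRingEnd ℂ) (f₂ x) * (w * (ζ - z)))
    rw [norm_mul, norm_mul, norm_mul, RCLike.norm_conj, RCLike.norm_conj] at hre
    have hwv : 0 ≤ ‖w‖ * ‖ζ - z‖ := by positivity
    set N := ‖f₁ x‖ ^ 2 + ‖f₂ x‖ ^ 2 with hN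
    have hAG : 2 * (‖f₁ x‖ * ‖f₂ x‖) ≤ N := by nlinarith [sq_nonneg (‖f₁ x‖ - ‖f₂ x‖)]
    have hmN' : m ≤ N / c := by rw [le_div_iff₀ hc]; linarith
    calc ‖(2 : ℝ)‖ * ‖((starRingEnd ℂ) (f₁ x) * (starRingEnd ℂ) (f₂ x) * (w * (ζ - z))).re‖ * m
        ≤ 2 * (‖f₁ x‖ * ‖f₂ x‖ * (‖w‖ * ‖ζ - z‖)) * m := by
          rw [Real.norm_two, Real.norm_eq_abs]
          gcongr
      _ = (2 * (‖f₁ x‖ * ‖f₂ x‖)) * (‖w‖ * ‖ζ - z‖) * m := by ring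
      _ ≤ N * (‖w‖ * ‖ζ - z‖) * (N / c) := by gcongr
      _ = ‖w‖ / c * ‖ζ - z‖ * N ^ 2 := by ring
  choose! d hd hdb using hSd
  have key := (convex_Icc (0 : ℝ) 1).norm_image_sub_le_of_norm_hasDerivWithin_le
    (fun t ht => (hd t ht).hasDerivWithinAt) hdb (left_mem_Icc.2 zero_le_one)
    (right_mem_Icc.2 zero_le_one)
  have hS0 : S 0 = 0 := by simp [hS, hz0]
  have hζ1 : f₁ ζ ≠ 0 := fun h => hw (by rw [← hW ζ hζD, h, hζ0]; ring)
  have hS1 : S 1 = 1 := by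
    have : ‖f₁ ζ‖ ≠ 0 := norm_ne_zero_iff.2 hζ1
    simp [hS, hζ0, this]
  rw [hS0, hS1, sub_zero, norm_one, mul_one, le_div_iff₀ hm0, one_mul] at key
  exact key

theorem mainTheorem6 (A : ℂ → ℂ) (hA : AnalyticOnNhd ℂ A unitDisc)
    (C : ℝ) (hC : 0 < C)
    (hbound : ∀ z ∈ unitDisc, ‖A z‖ * (1 - ‖z‖ ^ 2) ^ 2 ≤ 1 + C * (1 - ‖z‖))
    (f₁ f₂ : ℂ → ℂ) (hf₁ : IsSolution A f₁) (hf₂ : IsSolution A f₂)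
    (hind : LinearIndependent ℂ ![unitDisc.domRestrict f₁, unitDisc.domRestrict f₂]) :
    ∃ δ : ℝ, 0 < δ ∧ ∀ z ∈ zerosInDisc f₁, ∀ ζ ∈ zerosInDisc f₂, δ < hypDist z ζ := by
  obtain ⟨w, hw, hW⟩ := exists_wronskian_eq hf₁ hf₂ hind
  obtain ⟨c, hc, hlow⟩ := exists_mul_one_sub_sq_le_normSq_add hC hbound hf₁ hf₂ hw hW
  set k := ‖w‖ / c
  have hk : 0 ≤ k := by positivity
  -- The pseudo-hyperbolic distance is at least `1 / (2 * k + 1)`. One factor 1/2 is lost in passing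
  -- to `hypDist`, the other makes the inequality strict.
  refine ⟨1 / (2 * k + 1) / 4, by positivity, fun z hz ζ hζ => ?_⟩
  have hz1 := mem_unitDisc.1 hz.1
  have hζ1 := mem_unitDisc.1 hζ.1
  have hsep := le_norm_sub_of_zeros hf₁ hf₂ hw hW hc hlow hz hζ
  have hden := norm_one_sub_conj_mul_le z ζ hz1 hζ1
  have hpos := norm_pos_iff.2 (one_sub_conj_mul_ne_zero hz1 hζ1)
  have hρ : 1 / (2 * k + 1) ≤ pseudoHypDist z ζ := by
    rw [pseudoHypDist, discAut, norm_div, div_le_div_iff₀ (by positivity) hpos, one_mul,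
      norm_sub_rev z ζ]
    linarith
  have hpk : 0 < 1 / (2 * k + 1) := by positivity
  linarith [half_pseudoHypDist_le_hypDist hz1 hζ1]
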